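/- Let $n,p$ be integers with $1\le p<n$, and let $0<\varepsilon<1$, $0<\delta<\tfrac12$ and $\sigma\in\mathbb R$. A data set is a matrix $X\in\mathbb R^{n\times p}$ with $|x_{ij}|\le 1$ for all $i,j$. Two data sets $X,X'$ are neighbors if they differ in at most one row and $\|X-X'\|\le 1$, where $\|\cdot\|$ is the Frobenius ($L_2$) norm. A release mechanism $X\mapsto Y(X)$ (a random $n\times p$ matrix) is $(\varepsilon,\delta)$-differentially private (DP) if $$P[Y(X)\in S]\le e^{\varepsilon}P[Y(X')\in S]+\delta$$ for all neighboring data sets $X,X'$ and all measurable $S\subseteq\mathbb R^{n\times p}$. Let $A$ be uniformly (Haar) distributed on the group of $n\times n$ orthogonal matrices and let $C$ be an $n\times p$ matrix with independent $N(0,\sigma^2)$ entries, independent of $A$. Consider the mechanisms $$\text{(B)}\quad Y(X)=A(X+C),\qquad\qquad \text{(C)}\quad Y(X)=AX+C .$$ Let $\bar\gamma_\delta$ be the upper $\delta$-quantile of the standard Gaussian distribution $N(0,1)$, let $\gamma_{\delta,np}$ be the upper $\delta$-quantile of the $\chi^2$ distribution with $np$ degrees of freedom, and put $b=(n-p)\sqrt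 p+2p\,\gamma_{\delta,np}$. If $$\sigma\ \ge\ \min\left(\frac{\bar\gamma_\delta}{\varepsilon}\Bigl(1+\frac{1}{2\bar\gamma_\delta^2}\Bigr),\ \sqrt{\frac{b+\sqrt{b^2+8np^2(n-p)\varepsilon}}{2(n-p)\varepsilon}}\right),$$ then both mechanism (B) and mechanism (C) are $(\varepsilon,\delta)$-DP. -/

import Mathlib

open MeasureTheory ProbabilityTheory

/-! ### The measurable structure on real matrices and the compact group `O(n)` -/

instance matrixMeasurableSpace (m n : Type*) : MeasurableSpace (Matrix m n ℝ) :=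
  MeasurableSpace.pi

instance matrixBorelSpace (m n : Type*) [Countable m] [Countable n] :
    BorelSpace (Matrix m n ℝ) :=
  inferInstanceAs (BorelSpace (m → n → ℝ))

instance orthogonalGroupCompactSpace (n : ℕ) :
    CompactSpace (Matrix.orthogonalGroup (Fin n) ℝ) := by
  apply isCompact_iff_compactSpace.mp
  have hK : IsCompact (Set.univ.pi fun _ : Fin n => Set.univ.pi fun _ : Fin n =>
      Set.Icc (-1 : ℝ) 1) :=
    isCompact_univ_pi fun _ => isCompact_univ_pi fun _ => isCompact_Icc
  have hcl : IsClosed (Matrix.orthogonalGroup (Fin n) ℝ : Set (Matrix (Fin n) (Fin n) ℝ)) :=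
    isClosed_unitary
  refine IsCompact.of_isClosed_subset hK hcl ?_
  intro U hU i _ j _
  have h := entry_norm_bound_of_unitary (𝕜 := ℝ) hU i j
  exact abs_le.mp h

/-- The uniform distribution on the group of `n × n` orthogonal matrices: its Haar measure,
normalized to total mass one. -/
noncomputable def uniformOrthogonal (n : ℕ) : Measure (Matrix.orthogonalGroup (Fin n) ℝ) :=
  Measure.haarMeasure ⊤

/-- The law `NI_{n × p}(0, σ²)` of an `n × p` matrix with independent `N(0, σ²)` entries. -/
noncomputable def noiseLaw (n p : ℕ) (σ : ℝ) : Measure (Matrix (Fin n) (Fin p) ℝ) :=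
  (Measure.pi fun _ : Fin n => Measure.pi fun _ : Fin p =>
    gaussianReal 0 (Real.toNNReal (σ ^ 2))).map Matrix.of

/-! ### Data sets, neighbors, mechanisms and differential privacy -/

/-- A data set: an `n × p` matrix all of whose entries have magnitude at most one. -/
def IsDataSet {n p : ℕ} (X : Matrix (Fin n) (Fin p) ℝ) : Prop :=
  ∀ i j, |X i j| ≤ 1

section
attribute [local instance] Matrix.frobeniusNormedAddCommGroup

/-- Two data sets are neighbors if they agree outside one row and `‖X - X'‖ ≤ 1`
in the Frobenius (entrywise `L²`) norm. -/
def Neighbors {n p : ℕ} (X X' : Matrix (Fin n) (Fin p) ℝ) : Prop :=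
  IsDataSet X ∧ IsDataSet X' ∧ ‖X - X'‖ ≤ 1 ∧ ∃ i, ∀ k, k ≠ i → X k = X' k

end

/-- `(ε, δ)`-differential privacy of the mechanism that releases, for the data set `X`,
a random matrix with law `M X`. -/
def IsDifferentiallyPrivate {n p : ℕ}
    (M : Matrix (Fin n) (Fin p) ℝ → Measure (Matrix (Fin n) (Fin p) ℝ)) (ε δ : ℝ) : Prop :=
  ∀ X X' : Matrix (Fin n) (Fin p) ℝ, Neighbors X X' →
    ∀ S : Set (Matrix (Fin n) (Fin p) ℝ), MeasurableSet S →
      M X S ≤ ENNReal.ofReal (Real.exp ε) * M X' S + ENNReal.ofReal δ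

/-- Setting (B): the law of `Y = A (X + C)`, where `A` is uniform on the orthogonal group,
`C` has independent `N(0, σ²)` entries, and `A` and `C` are independent. -/
noncomputable def mechanismB (n p : ℕ) (σ : ℝ) (X : Matrix (Fin n) (Fin p) ℝ) :
    Measure (Matrix (Fin n) (Fin p) ℝ) :=
  ((uniformOrthogonal n).prod (noiseLaw n p σ)).map
    fun AC => (AC.1 : Matrix (Fin n) (Fin n) ℝ) * (X + AC.2)

/-- Setting (C): the law of `Y = A X + C`, with `A` and `C` as in setting (B). -/
noncomputable def mechanismC (n p : ℕ) (σ : ℝ) (X : Matrix (Fin n) (Fin p) ℝ) :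
    Measure (Matrix (Fin n) (Fin p) ℝ) :=
  ((uniformOrthogonal n).prod (noiseLaw n p σ)).map
    fun AC => (AC.1 : Matrix (Fin n) (Fin n) ℝ) * X + AC.2

/-! ### Quantiles and the two noise bounds -/

/-- The upper `δ`-quantile of a distribution `μ` on the real line: the least `t` with
`μ (t, ∞) ≤ δ`. -/
noncomputable def upperQuantile (μ : Measure ℝ) (δ : ℝ) : ℝ :=
  sInf {t : ℝ | μ (Set.Ioi t) ≤ ENNReal.ofReal δ}

/-- The `χ²` distribution with `k` degrees of freedom: the law of the sum of the squares of `k`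
independent standard Gaussian variables. -/
noncomputable def chiSquared (k : ℕ) : Measure ℝ :=
  (Measure.pi fun _ : Fin k => gaussianReal 0 1).map fun z => ∑ i, z i ^ 2

/-- The upper `δ`-quantile of the standard Gaussian distribution. -/
noncomputable def gaussianQuantile (δ : ℝ) : ℝ :=
  upperQuantile (gaussianReal 0 1) δ

/-- The upper `δ`-quantile of the `χ²` distribution with `k` degrees of freedom. -/
noncomputable def chiSquaredQuantile (δ : ℝ) (k : ℕ) : ℝ :=
  upperQuantile (chiSquared k) δ

/-- The noise bound for the unmasked release `Y = X + C`. -/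
noncomputable def unmaskedBound (ε δ : ℝ) : ℝ :=
  gaussianQuantile δ / ε * (1 + 1 / (2 * gaussianQuantile δ ^ 2))

/-- `b = (n - p) √p + 2 p γ`, with `γ` the upper `δ`-quantile of `χ²` with `n p` degrees of
freedom. -/
noncomputable def maskedCoeff (n p : ℕ) (δ : ℝ) : ℝ :=
  ((n : ℝ) - p) * √p + 2 * p * chiSquaredQuantile δ (n * p)

/-- The bound on the noise variance `σ²` for the masked releases. -/
noncomputable def maskedVarianceBound (n p : ℕ) (ε δ : ℝ) : ℝ :=
  (maskedCoeff n p δ + √(maskedCoeff n p δ ^ 2 + 8 * n * p ^ 2 * ((n : ℝ) - p) * ε)) /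
    (2 * ((n : ℝ) - p) * ε)

/-! ### The Frobenius inner product -/

section FrobeniusInner

variable {m n p : ℕ}

/-! Gaussian noise is invariant under rotation, so AC and C have the same law even conditionally on
A, and (B) and (C) release the same distribution (`mechanismB_eq_mechanismC`). It remains to treat
(C), and either term of the minimum suffices by itself.

Unmasked bound: for fixed A the release is a Gaussian mechanism applied to AX. Since AX and AX' are
as close as X and X', `gaussian_mechanism` applies, and its inequality survives averaging over A.

Masked bound: relative to the noise law, Y has density exp(-‖X‖²/2σ²) ∫ exp⟨AX, W⟩ dA with W = Y/σ²
(`mechanismC_apply_eq_setLIntegral`). The heart is `orbitIntegral_le`, which bounds the change of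
the orbital integral between neighbors. Along the segment from X' to X its logarithmic derivative is
the mean of one bilinear expression in A under the tilted law exp⟨AX, W⟩ dA. A Stein identity on
O(n), using rotations that mix the changed coordinate with a unit vector v in the left kernel of X,
rewrites this mean as that of a product of two v-components. There are at least n - p orthonormal
choices of v, all giving the same value, so Bessel and Cauchy–Schwarz gain a factor 1/(n - p)
(`abs_integral_langevin_le`). The resulting loss is controlled by ‖Y‖², which is bounded outside an
event of probability δ (`mechanismC_large_norm_le`). Requiring total loss at most ε is a quadratic
inequality in σ², solved in `privacy_loss_le`. -/

/-- The Frobenius inner product of two real matrices. -/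
def frobInner (X Y : Matrix (Fin n) (Fin p) ℝ) : ℝ := (X.transpose * Y).trace

lemma frobInner_eq_sum (X Y : Matrix (Fin n) (Fin p) ℝ) :
    frobInner X Y = ∑ i, ∑ j, X i j * Y i j := by
  rw [Finset.sum_comm]
  simp [frobInner, Matrix.trace, Matrix.mul_apply]

lemma frobInner_comm (X Y : Matrix (Fin n) (Fin p) ℝ) : frobInner X Y = frobInner Y X := by
  simp only [frobInner_eq_sum, mul_comm]

lemma frobInner_add_left (X Y Z : Matrix (Fin n) (Fin p) ℝ) :
    frobInner (X + Y) Z = frobInner X Z + frobInner Y Z := by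
  simp [frobInner, Matrix.add_mul]

lemma frobInner_add_right (X Y Z : Matrix (Fin n) (Fin p) ℝ) :
    frobInner X (Y + Z) = frobInner X Y + frobInner X Z := by
  simp [frobInner, Matrix.mul_add]

lemma frobInner_sub_left (X Y Z : Matrix (Fin n) (Fin p) ℝ) :
    frobInner (X - Y) Z = frobInner X Z - frobInner Y Z := by
  simp [frobInner, Matrix.sub_mul]

lemma frobInner_sub_right (X Y Z : Matrix (Fin n) (Fin p) ℝ) :
    frobInner X (Y - Z) = frobInner X Y - frobInner X Z := by
  simp [frobInner, Matrix.mul_sub]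

lemma frobInner_smul_left (c : ℝ) (X Y : Matrix (Fin n) (Fin p) ℝ) :
    frobInner (c • X) Y = c * frobInner X Y := by
  simp [frobInner]

lemma frobInner_smul_right (c : ℝ) (X Y : Matrix (Fin n) (Fin p) ℝ) :
    frobInner X (c • Y) = c * frobInner X Y := by
  simp [frobInner]

lemma frobInner_mul_left (A : Matrix (Fin m) (Fin n) ℝ) (X : Matrix (Fin n) (Fin p) ℝ)
    (Y : Matrix (Fin m) (Fin p) ℝ) : frobInner (A * X) Y = frobInner X (A.transpose * Y) := by
  simp [frobInner, Matrix.transpose_mul, Matrix.mul_assoc]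

lemma frobInner_mul_eq_trace (A : Matrix (Fin m) (Fin n) ℝ) (X : Matrix (Fin n) (Fin p) ℝ)
    (Y : Matrix (Fin m) (Fin p) ℝ) : frobInner (A * X) Y = (X * Y.transpose * A).trace := by
  rw [frobInner_comm, frobInner, ← Matrix.mul_assoc, Matrix.trace_mul_comm, Matrix.mul_assoc]

lemma frobInner_self_nonneg (X : Matrix (Fin n) (Fin p) ℝ) : 0 ≤ frobInner X X := by
  rw [frobInner_eq_sum]
  exact Finset.sum_nonneg fun i _ => Finset.sum_nonneg fun j _ => mul_self_nonneg _

lemma frobInner_self_eq_zero {X : Matrix (Fin n) (Fin p) ℝ} (h : frobInner X X = 0) : X = 0 := by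
  rw [frobInner_eq_sum] at h
  ext i j
  have hi := (Finset.sum_eq_zero_iff_of_nonneg
    fun i _ => Finset.sum_nonneg fun j _ => mul_self_nonneg (X i j)).mp h i (Finset.mem_univ i)
  exact mul_self_eq_zero.mp ((Finset.sum_eq_zero_iff_of_nonneg
    fun j _ => mul_self_nonneg (X i j)).mp hi j (Finset.mem_univ j))

lemma frobInner_orthogonal_mul (A : Matrix.orthogonalGroup (Fin n) ℝ)
    (X Y : Matrix (Fin n) (Fin p) ℝ) :
    frobInner ((A : Matrix (Fin n) (Fin n) ℝ) * X) ((A : Matrix (Fin n) (Fin n) ℝ) * Y) =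
      frobInner X Y := by
  have h : (A : Matrix (Fin n) (Fin n) ℝ).transpose * (A : Matrix (Fin n) (Fin n) ℝ) = 1 :=
    (Matrix.mem_orthogonalGroup_iff' _ _).mp A.2
  rw [frobInner_mul_left, ← Matrix.mul_assoc, h, Matrix.one_mul]

lemma frobInner_add_self_le (X Y : Matrix (Fin n) (Fin p) ℝ) :
    frobInner (X + Y) (X + Y) ≤ 2 * frobInner X X + 2 * frobInner Y Y := by
  have h := frobInner_self_nonneg (X - Y)
  simp only [frobInner_sub_left, frobInner_sub_right] at h
  simp only [frobInner_add_left, frobInner_add_right]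
  linarith

lemma continuous_frobInner :
    Continuous fun Z : Matrix (Fin n) (Fin p) ℝ × Matrix (Fin n) (Fin p) ℝ =>
      frobInner Z.1 Z.2 := by
  unfold frobInner
  fun_prop

end FrobeniusInner

/-! ### Haar measure on the orthogonal group -/

section OrthogonalGroup

variable {n : ℕ}

instance matrixSecondCountableTopology (m n : Type*) [Countable m] [Countable n] :
    SecondCountableTopology (Matrix m n ℝ) :=
  inferInstanceAs (SecondCountableTopology (m → n → ℝ))

instance orthogonalGroupSecondCountableTopology (n : ℕ) :
    SecondCountableTopology (Matrix.orthogonalGroup (Fin n) ℝ) :=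
  inferInstanceAs (SecondCountableTopology
    (Matrix.orthogonalGroup (Fin n) ℝ : Set (Matrix (Fin n) (Fin n) ℝ)))

instance uniformOrthogonal_isHaarMeasure (n : ℕ) : (uniformOrthogonal n).IsHaarMeasure := by
  unfold uniformOrthogonal
  infer_instance

instance uniformOrthogonal_isProbabilityMeasure (n : ℕ) :
    IsProbabilityMeasure (uniformOrthogonal n) :=
  ⟨Measure.haarMeasure_self (K₀ := ⊤)⟩

/-- Compact groups are unimodular: a right translate of Haar measure is again a Haar probability
measure, and there is only one. -/
instance uniformOrthogonal_isMulRightInvariant (n : ℕ) :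
    (uniformOrthogonal n).IsMulRightInvariant := by
  refine ⟨fun g => ?_⟩
  have : IsProbabilityMeasure ((uniformOrthogonal n).map (· * g)) :=
    Measure.isProbabilityMeasure_map (measurable_mul_const g).aemeasurable
  have : ((uniformOrthogonal n).map (· * g)).IsHaarMeasure := inferInstance
  exact Measure.isHaarMeasure_eq_of_isProbabilityMeasure _ _

lemma integrable_uniformOrthogonal {f : Matrix.orthogonalGroup (Fin n) ℝ → ℝ}
    (hf : Continuous f) : Integrable f (uniformOrthogonal n) :=
  hf.integrable_of_hasCompactSupport (HasCompactSupport.of_compactSpace f)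

section Rotation

attribute [local instance] Matrix.linftyOpNormedRing Matrix.linftyOpNormedAlgebra

/-- Every skew-symmetric matrix generates a one-parameter family of orthogonal matrices. -/
lemma exists_orthogonal_curve {K : Matrix (Fin n) (Fin n) ℝ} (hK : K.transpose = -K) :
    ∃ R : ℝ → Matrix.orthogonalGroup (Fin n) ℝ, R 0 = 1 ∧
      ∀ (M : Matrix (Fin n) (Fin n) ℝ) (t : ℝ),
        HasDerivAt (fun s => (M * (R s : Matrix (Fin n) (Fin n) ℝ)).trace)
          (M * (R t : Matrix (Fin n) (Fin n) ℝ) * K).trace t := by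
  have hmem (t : ℝ) : NormedSpace.exp (t • K) ∈ Matrix.orthogonalGroup (Fin n) ℝ := by
    refine (Matrix.mem_orthogonalGroup_iff _ _).mpr ?_
    rw [← Matrix.exp_transpose, Matrix.transpose_smul, hK, ← Matrix.exp_add_of_commute]
    · simp
    · exact (((Commute.refl K).smul_left t).neg_right).smul_right t
  refine ⟨fun t => ⟨_, hmem t⟩, Subtype.ext (by simp), fun M t => ?_⟩
  have h := hasDerivAt_exp_smul_const (𝕂 := ℝ) K t
  let T : Matrix (Fin n) (Fin n) ℝ →ₗ[ℝ] ℝ :=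
    Matrix.traceLinearMap (Fin n) ℝ ℝ ∘ₗ LinearMap.mulLeft ℝ M
  have hT := (LinearMap.toContinuousLinearMap T).hasFDerivAt.comp_hasDerivAt t h
  rw [Matrix.mul_assoc]
  exact hT

end Rotation

/-- By right invariance, the integral of tr(MA) exp tr(FA) does not change when A is replaced by A
R(t), where R is the rotation curve generated by K. The integrand here is the derivative at t = 0.
-/
lemma stein_identity (M F : Matrix (Fin n) (Fin n) ℝ) {K : Matrix (Fin n) (Fin n) ℝ}
    (hK : K.transpose = -K) :
    ∫ A : Matrix.orthogonalGroup (Fin n) ℝ,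
      ((M * A.1 * K).trace + (M * A.1).trace * (F * A.1 * K).trace) * Real.exp (F * A.1).trace
        ∂(uniformOrthogonal n) = 0 := by
  obtain ⟨R, hR0, hR⟩ := exists_orthogonal_curve hK
  set ψ : Matrix.orthogonalGroup (Fin n) ℝ → ℝ := fun A =>
    ((M * A.1 * K).trace + (M * A.1).trace * (F * A.1 * K).trace) * Real.exp (F * A.1).trace
    with hψ
  have hψc : Continuous ψ := by fun_prop
  set g : Matrix.orthogonalGroup (Fin n) ℝ → ℝ := fun A =>
    (M * A.1).trace * Real.exp (F * A.1).trace with hg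
  have hgc : Continuous g := by fun_prop
  obtain ⟨C, hC⟩ := isCompact_univ.exists_bound_of_continuousOn hψc.continuousOn
  have key := (hasDerivAt_integral_of_dominated_loc_of_deriv_le (μ := uniformOrthogonal n)
    (F := fun t A => g (A * R t)) (F' := fun t A => ψ (A * R t)) (x₀ := (0 : ℝ))
    (bound := fun _ => C) Filter.univ_mem
    (Filter.Eventually.of_forall fun t =>
      (hgc.comp (continuous_mul_const (R t))).aestronglyMeasurable)
    (integrable_uniformOrthogonal (hgc.comp (continuous_mul_const (R 0))))
    (hψc.comp (continuous_mul_const (R 0))).aestronglyMeasurable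
    (Filter.Eventually.of_forall fun A t _ => hC _ (Set.mem_univ _))
    (integrable_const C)
    (Filter.Eventually.of_forall fun A t _ => by
      have h1 := hR (M * A.1) t
      have h2 := (hR (F * A.1) t).exp
      have h3 := h1.mul h2
      simp only [hg, hψ, Submonoid.coe_mul, ← Matrix.mul_assoc]
      refine h3.congr_deriv ?_
      ring)).2
  simp only [integral_mul_right_eq_self, hR0, mul_one] at key
  exact key.unique (hasDerivAt_const _ _)

/-- The substitution A ↦ AQ fixes the weight and flips the sign of the linear factor. -/
lemma integral_reflect (M F : Matrix (Fin n) (Fin n) ℝ) (Q : Matrix.orthogonalGroup (Fin n) ℝ)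
    (hQ : Q.1 * F = F) (hM : Q.1 * M = -M) :
    ∫ A : Matrix.orthogonalGroup (Fin n) ℝ, (M * A.1).trace * Real.exp (F * A.1).trace
      ∂(uniformOrthogonal n) = 0 := by
  refine integral_eq_zero_of_mul_right_eq_neg (g := Q) fun A => ?_
  have h (N : Matrix (Fin n) (Fin n) ℝ) :
      (N * (A * Q).1).trace = (Q.1 * N * A.1).trace := by
    rw [Submonoid.coe_mul, ← Matrix.mul_assoc, Matrix.trace_mul_comm, ← Matrix.mul_assoc]
  rw [h, h, hQ, hM]
  simp

end OrthogonalGroup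

/-! ### Tilted means over the orthogonal group -/

section LangevinBound

variable {n p : ℕ}

-- Stein's identity for M = v wᵀ and the generator K = e vᵀ - v eᵀ. Because v kills X from the left,
-- only one term of tr(FAK) survives; the leftover term in v ⬝ᵥ e vanishes by reflection in the
-- hyperplane orthogonal to v.
open Matrix in
lemma integral_langevin_eq (X W : Matrix (Fin n) (Fin p) ℝ) (e w v : Fin n → ℝ)
    (hv : v ⬝ᵥ v = 1) (hX : v ᵥ* X = 0) :
    ∫ A : Matrix.orthogonalGroup (Fin n) ℝ,
        (e ⬝ᵥ (w ᵥ* A.1)) * Real.exp (X * Wᵀ * A.1).trace ∂(uniformOrthogonal n) =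
      ∫ A : Matrix.orthogonalGroup (Fin n) ℝ,
        (v ⬝ᵥ (w ᵥ* A.1)) * (v ⬝ᵥ ((W *ᵥ (e ᵥ* X)) ᵥ* A.1)) *
          Real.exp (X * Wᵀ * A.1).trace ∂(uniformOrthogonal n) := by
  have hK : (vecMulVec e v - vecMulVec v e)ᵀ = -(vecMulVec e v - vecMulVec v e) := by
    rw [transpose_sub, transpose_vecMulVec, transpose_vecMulVec, neg_sub]
  have hS := stein_identity (vecMulVec v w) (X * Wᵀ) hK
  have hQt : (1 - (2 : ℝ) • vecMulVec v v)ᵀ = 1 - (2 : ℝ) • vecMulVec v v := by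
    simp [transpose_vecMulVec]
  have hvv : vecMulVec v v * vecMulVec v v = vecMulVec v v := by
    rw [vecMulVec_mul_vecMulVec, hv, one_smul]
  have hQ : (1 - (2 : ℝ) • vecMulVec v v) ∈ Matrix.orthogonalGroup (Fin n) ℝ := by
    refine (Matrix.mem_orthogonalGroup_iff _ _).mpr ?_
    rw [hQt]
    simp only [sub_mul, mul_sub, one_mul, mul_one, smul_mul_assoc, mul_smul_comm, hvv]
    module
  have hR := integral_reflect (vecMulVec v w) (X * Wᵀ) ⟨_, hQ⟩
    (by simp [Matrix.sub_mul, vecMulVec_mul, ← Matrix.vecMul_vecMul, hX])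
    (by
      simp only [Matrix.sub_mul, Matrix.one_mul, Matrix.smul_mul, vecMulVec_mul_vecMulVec, hv,
        one_smul]
      module)
  have h1 (A : Matrix (Fin n) (Fin n) ℝ) :
      (vecMulVec v w * A).trace = v ⬝ᵥ (w ᵥ* A) := by
    rw [vecMulVec_mul, trace_vecMulVec]
  have h2 (A : Matrix (Fin n) (Fin n) ℝ) :
      (vecMulVec v w * A * (vecMulVec e v - vecMulVec v e)).trace =
        e ⬝ᵥ (w ᵥ* A) - (v ⬝ᵥ e) * (v ⬝ᵥ (w ᵥ* A)) := by
    rw [vecMulVec_mul, Matrix.mul_sub, vecMulVec_mul_vecMulVec, vecMulVec_mul_vecMulVec, trace_sub,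
      trace_vecMulVec, trace_vecMulVec, dotProduct_smul, dotProduct_smul, hv,
      dotProduct_comm e, dotProduct_comm v (w ᵥ* A)]
    simp only [smul_eq_mul]
    ring
  have h3 (A : Matrix (Fin n) (Fin n) ℝ) :
      (X * Wᵀ * A * (vecMulVec e v - vecMulVec v e)).trace =
        -(v ⬝ᵥ ((W *ᵥ (e ᵥ* X)) ᵥ* A)) := by
    have hv0 : v ᵥ* (X * Wᵀ * A) = 0 := by
      rw [Matrix.mul_assoc, ← vecMul_vecMul, hX, zero_vecMul]
    have he0 : e ᵥ* (X * Wᵀ * A) = (W *ᵥ (e ᵥ* X)) ᵥ* A := by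
      rw [← vecMul_vecMul, ← vecMul_vecMul, vecMul_transpose]
    rw [Matrix.mul_sub, mul_vecMulVec, mul_vecMulVec, trace_sub, trace_vecMulVec, trace_vecMulVec,
      dotProduct_comm _ v, dotProduct_comm _ e, dotProduct_mulVec v, dotProduct_mulVec e, hv0, he0,
      zero_dotProduct, zero_sub, dotProduct_comm]
  simp only [h1] at hR
  simp only [h1, h2, h3] at hS
  have hc (a b : Fin n → ℝ) : Continuous fun A : Matrix.orthogonalGroup (Fin n) ℝ =>
      a ⬝ᵥ (b ᵥ* A.1) := by fun_prop
  have hE : Continuous fun A : Matrix.orthogonalGroup (Fin n) ℝ =>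
      Real.exp (X * Wᵀ * A.1).trace := by fun_prop
  have i1 := integrable_uniformOrthogonal ((hc e w).fun_mul hE)
  have i2 := integrable_uniformOrthogonal ((hc v w).fun_mul hE)
  have i3 := integrable_uniformOrthogonal (((hc v w).fun_mul (hc v (W *ᵥ (e ᵥ* X)))).fun_mul hE)
  have hsplit : ∀ A : Matrix.orthogonalGroup (Fin n) ℝ,
      (e ⬝ᵥ (w ᵥ* A.1) - (v ⬝ᵥ e) * (v ⬝ᵥ (w ᵥ* A.1)) +
        v ⬝ᵥ (w ᵥ* A.1) * -(v ⬝ᵥ ((W *ᵥ (e ᵥ* X)) ᵥ* A.1))) * Real.exp (X * Wᵀ * A.1).trace =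
      (e ⬝ᵥ (w ᵥ* A.1)) * Real.exp (X * Wᵀ * A.1).trace -
        (v ⬝ᵥ e) * ((v ⬝ᵥ (w ᵥ* A.1)) * Real.exp (X * Wᵀ * A.1).trace) -
        (v ⬝ᵥ (w ᵥ* A.1)) * (v ⬝ᵥ ((W *ᵥ (e ᵥ* X)) ᵥ* A.1)) *
          Real.exp (X * Wᵀ * A.1).trace := fun A => by ring
  simp only [hsplit] at hS
  have i12 : Integrable (fun A : Matrix.orthogonalGroup (Fin n) ℝ =>
      (e ⬝ᵥ (w ᵥ* A.1)) * Real.exp (X * Wᵀ * A.1).trace -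
        (v ⬝ᵥ e) * ((v ⬝ᵥ (w ᵥ* A.1)) * Real.exp (X * Wᵀ * A.1).trace))
      (uniformOrthogonal n) := i1.sub (i2.const_mul _)
  rw [integral_sub i12 i3, integral_sub i1 (i2.const_mul _),
    integral_const_mul, hR] at hS
  linarith

/-- The left kernel of an `n × p` matrix has an orthonormal family of at least `n - p` vectors. -/
lemma exists_orthonormal_vecMul_eq_zero (X : Matrix (Fin n) (Fin p) ℝ) :
    ∃ (q : ℕ) (v : Fin q → EuclideanSpace ℝ (Fin n)), n ≤ q + p ∧ Orthonormal ℝ v ∧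
      ∀ i, Matrix.vecMul (v i).ofLp X = 0 := by
  let T : EuclideanSpace ℝ (Fin n) →ₗ[ℝ] (Fin p → ℝ) :=
    X.vecMulLinear ∘ₗ (WithLp.linearEquiv 2 ℝ (Fin n → ℝ)).toLinearMap
  refine ⟨Module.finrank ℝ (LinearMap.ker T),
    fun i => (stdOrthonormalBasis ℝ (LinearMap.ker T) i : EuclideanSpace ℝ (Fin n)), ?_, ?_, ?_⟩
  · have h1 := T.finrank_range_add_finrank_ker
    have h2 := (LinearMap.range T).finrank_le
    simp only [finrank_euclideanSpace, Fintype.card_fin, Module.finrank_fintype_fun_eq_card]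
      at h1 h2
    omega
  · exact (stdOrthonormalBasis ℝ (LinearMap.ker T)).orthonormal.comp_linearIsometry
      (LinearMap.ker T).subtypeₗᵢ
  · intro i
    exact (stdOrthonormalBasis ℝ (LinearMap.ker T) i).2

open Matrix in
lemma bessel_orthogonal {q : ℕ} {v : Fin q → EuclideanSpace ℝ (Fin n)} (hv : Orthonormal ℝ v)
    (A : Matrix.orthogonalGroup (Fin n) ℝ) (w : Fin n → ℝ) :
    ∑ i, ((v i).ofLp ⬝ᵥ (w ᵥ* A.1)) ^ 2 ≤ w ⬝ᵥ w := by
  have h := hv.sum_inner_products_le (WithLp.toLp 2 (w ᵥ* A.1)) (s := Finset.univ)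
  have hA : A.1 * A.1ᵀ = 1 := (Matrix.mem_orthogonalGroup_iff _ _).mp A.2
  have hw : (w ᵥ* A.1) ⬝ᵥ (w ᵥ* A.1) = w ⬝ᵥ w := by
    rw [← dotProduct_mulVec, ← vecMul_transpose, vecMul_vecMul, hA, vecMul_one]
  rw [← hw]
  simpa only [EuclideanSpace.inner_eq_star_dotProduct, EuclideanSpace.norm_sq_eq, dotProduct,
    Real.norm_eq_abs, sq_abs, star_trivial, mul_comm, ← pow_two, Pi.star_apply] using h

-- The left side does not involve v, so the preceding identity can be summed over an orthonormal
-- family in the left kernel. This multiplies the left side by at least n - p, while Bessel keeps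
-- the right side bounded independently of the family's size.
open Matrix in
lemma abs_integral_langevin_le (X W : Matrix (Fin n) (Fin p) ℝ) (hnp : p < n)
    (e w : Fin n → ℝ) {a b : ℝ} (ha : 0 ≤ a) (hb : 0 ≤ b) (hw : w ⬝ᵥ w ≤ a ^ 2)
    (hz : (W *ᵥ (e ᵥ* X)) ⬝ᵥ (W *ᵥ (e ᵥ* X)) ≤ b ^ 2) :
    |∫ A : Matrix.orthogonalGroup (Fin n) ℝ,
        (e ⬝ᵥ (w ᵥ* A.1)) * Real.exp (X * Wᵀ * A.1).trace ∂(uniformOrthogonal n)| ≤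
      a * b / ((n : ℝ) - p) * ∫ A : Matrix.orthogonalGroup (Fin n) ℝ,
        Real.exp (X * Wᵀ * A.1).trace ∂(uniformOrthogonal n) := by
  obtain ⟨q, v, hq, hv, hvX⟩ := exists_orthonormal_vecMul_eq_zero X
  have hvv (i : Fin q) : (v i).ofLp ⬝ᵥ (v i).ofLp = 1 := by
    have h := hv.1 i
    have h2 : ‖v i‖ ^ 2 = 1 := by rw [h]; norm_num
    simpa only [EuclideanSpace.norm_sq_eq, dotProduct, Real.norm_eq_abs, sq_abs, ← pow_two] using h2
  set I := ∫ A : Matrix.orthogonalGroup (Fin n) ℝ,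
        (e ⬝ᵥ (w ᵥ* A.1)) * Real.exp (X * Wᵀ * A.1).trace ∂(uniformOrthogonal n) with hI
  have hc (a b : Fin n → ℝ) : Continuous fun A : Matrix.orthogonalGroup (Fin n) ℝ =>
      a ⬝ᵥ (b ᵥ* A.1) := by fun_prop
  have hE : Continuous fun A : Matrix.orthogonalGroup (Fin n) ℝ =>
      Real.exp (X * Wᵀ * A.1).trace := by fun_prop
  have hsum : (q : ℝ) * I = ∫ A : Matrix.orthogonalGroup (Fin n) ℝ,
      (∑ i, ((v i).ofLp ⬝ᵥ (w ᵥ* A.1)) * ((v i).ofLp ⬝ᵥ ((W *ᵥ (e ᵥ* X)) ᵥ* A.1))) *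
        Real.exp (X * Wᵀ * A.1).trace ∂(uniformOrthogonal n) := by
    simp only [Finset.sum_mul]
    rw [integral_finsetSum _ fun i _ => integrable_uniformOrthogonal
      (((hc _ w).fun_mul (hc _ (W *ᵥ (e ᵥ* X)))).fun_mul hE)]
    rw [← Finset.sum_congr rfl fun i _ =>
      integral_langevin_eq X W e w (v i).ofLp (hvv i) (hvX i)]
    simp [hI]
  have hbound : |(q : ℝ) * I| ≤ ∫ A : Matrix.orthogonalGroup (Fin n) ℝ,
      a * b * Real.exp (X * Wᵀ * A.1).trace ∂(uniformOrthogonal n) := by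
    rw [hsum]
    refine norm_integral_le_of_norm_le (f := fun A : Matrix.orthogonalGroup (Fin n) ℝ =>
      (∑ i, ((v i).ofLp ⬝ᵥ (w ᵥ* A.1)) * ((v i).ofLp ⬝ᵥ ((W *ᵥ (e ᵥ* X)) ᵥ* A.1))) *
        Real.exp (X * Wᵀ * A.1).trace)
      (integrable_uniformOrthogonal (hE.const_mul _))
      (Filter.Eventually.of_forall fun A => ?_)
    rw [norm_mul, Real.norm_of_nonneg (Real.exp_pos _).le]
    refine mul_le_mul_of_nonneg_right ?_ (Real.exp_pos _).le
    -- Cauchy–Schwarz over the family, then Bessel for each of the two factors.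
    refine abs_le_of_sq_le_sq ?_ (mul_nonneg ha hb)
    calc _ ≤ _ := Finset.sum_mul_sq_le_sq_mul_sq Finset.univ _ _
      _ ≤ a ^ 2 * b ^ 2 := mul_le_mul ((bessel_orthogonal hv A w).trans hw)
          ((bessel_orthogonal hv A _).trans hz) (Finset.sum_nonneg fun i _ => sq_nonneg _)
          (sq_nonneg a)
      _ = (a * b) ^ 2 := by ring
  have hpos : (0 : ℝ) < n - p := sub_pos.mpr (by exact_mod_cast hnp)
  have hqn : (n : ℝ) - p ≤ q := by
    have : (n : ℝ) ≤ q + p := by exact_mod_cast hq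
    linarith
  rw [abs_mul, abs_of_nonneg (Nat.cast_nonneg q), integral_const_mul] at hbound
  rw [div_mul_eq_mul_div, le_div_iff₀ hpos, mul_comm]
  exact (mul_le_mul_of_nonneg_right hqn (abs_nonneg I)).trans hbound

end LangevinBound

/-! ### The exponential orbital integral -/

section OrbitIntegral

variable {n p : ℕ}

/-- The exponential orbital integral `∫ exp ⟨A X, W⟩ dA` over the orthogonal group. -/
noncomputable def orbitIntegral (X W : Matrix (Fin n) (Fin p) ℝ) : ℝ :=
  ∫ A : Matrix.orthogonalGroup (Fin n) ℝ,
    Real.exp (frobInner ((A : Matrix (Fin n) (Fin n) ℝ) * X) W) ∂(uniformOrthogonal n)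

lemma orbitIntegral_eq (X W : Matrix (Fin n) (Fin p) ℝ) :
    orbitIntegral X W = ∫ A : Matrix.orthogonalGroup (Fin n) ℝ,
      Real.exp (X * W.transpose * A.1).trace ∂(uniformOrthogonal n) := by
  simp only [orbitIntegral, frobInner_mul_eq_trace]

lemma orbitIntegral_pos (X W : Matrix (Fin n) (Fin p) ℝ) : 0 < orbitIntegral X W := by
  rw [orbitIntegral_eq]
  exact integral_exp_pos (integrable_uniformOrthogonal (by fun_prop))

lemma hasDerivAt_orbitIntegral (X D W : Matrix (Fin n) (Fin p) ℝ) (t : ℝ) :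
    HasDerivAt (fun s : ℝ => orbitIntegral (X + s • D) W)
      (∫ A : Matrix.orthogonalGroup (Fin n) ℝ, (D * W.transpose * A.1).trace *
        Real.exp ((X + t • D) * W.transpose * A.1).trace ∂(uniformOrthogonal n)) t := by
  simp only [orbitIntegral_eq]
  have hc : Continuous fun z : ℝ × Matrix.orthogonalGroup (Fin n) ℝ =>
      (D * W.transpose * z.2.1).trace *
        Real.exp ((X + z.1 • D) * W.transpose * z.2.1).trace := by fun_prop
  -- Compactness of [t - 1, t + 1] × O(n) supplies a constant dominating function.
  obtain ⟨C, hC⟩ := ((isCompact_Icc (a := t - 1) (b := t + 1)).prod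
    (isCompact_univ (X := Matrix.orthogonalGroup (Fin n) ℝ))).exists_bound_of_continuousOn
      hc.continuousOn
  refine (hasDerivAt_integral_of_dominated_loc_of_deriv_le (μ := uniformOrthogonal n)
    (F := fun s A => Real.exp ((X + s • D) * W.transpose * A.1).trace)
    (F' := fun s A => (D * W.transpose * A.1).trace *
        Real.exp ((X + s • D) * W.transpose * A.1).trace)
    (bound := fun _ => C) (Icc_mem_nhds (sub_one_lt t) (lt_add_one t))
    (Filter.Eventually.of_forall fun s => ?_) (integrable_uniformOrthogonal (by fun_prop)) ?_
    (Filter.Eventually.of_forall fun A s hs => hC (s, A) ⟨hs, Set.mem_univ _⟩)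
    (integrable_const C) (Filter.Eventually.of_forall fun A s _ => ?_)).2
  · exact (show Continuous _ by fun_prop).aestronglyMeasurable
  · exact (show Continuous _ by fun_prop).aestronglyMeasurable
  · have h : HasDerivAt (fun s : ℝ => (X * W.transpose * A.1).trace +
        s * (D * W.transpose * A.1).trace) (D * W.transpose * A.1).trace s := by
      simpa using ((hasDerivAt_id s).mul_const (D * W.transpose * A.1).trace).const_add
        (X * W.transpose * A.1).trace
    have h2 := h.exp
    simp only [Matrix.add_mul, Matrix.smul_mul, Matrix.trace_add, Matrix.trace_smul, smul_eq_mul]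
    rw [mul_comm]
    exact h2

open Matrix in
lemma mulVec_dotProduct_self_le (W : Matrix (Fin n) (Fin p) ℝ) (d : Fin p → ℝ) :
    (W *ᵥ d) ⬝ᵥ (W *ᵥ d) ≤ frobInner W W * (d ⬝ᵥ d) := by
  rw [frobInner_eq_sum, Finset.sum_mul]
  refine Finset.sum_le_sum fun i _ => ?_
  have h := Finset.sum_mul_sq_le_sq_mul_sq Finset.univ (fun j => W i j) d
  simpa only [mulVec, dotProduct, ← pow_two] using h

open Matrix in
/-- Replacing one row of a data set changes the orbital integral by a controlled factor. -/
theorem orbitIntegral_le (hnp : p < n) {X X' : Matrix (Fin n) (Fin p) ℝ} (hX : IsDataSet X)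
    (hX' : IsDataSet X') (hD : frobInner (X - X') (X - X') ≤ 1) {k : Fin n}
    (hk : ∀ i, i ≠ k → X i = X' i) (W : Matrix (Fin n) (Fin p) ℝ) :
    orbitIntegral X W ≤
      Real.exp (frobInner W W * √p / ((n : ℝ) - p)) * orbitIntegral X' W := by
  set L := frobInner W W * √p / ((n : ℝ) - p) with hL
  set e : Fin n → ℝ := Pi.single k 1 with he
  set d : Fin p → ℝ := e ᵥ* (X - X') with hd
  have hdj (j : Fin p) : d j = X k j - X' k j := by
    simp [hd, he]
  -- Only row k changes, so the direction of the segment has rank one and its trace functional has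
  -- the bilinear form treated above.
  have hDe : X - X' = vecMulVec e d := by
    ext i j
    by_cases hi : i = k
    · subst hi
      simp [vecMulVec_apply, hdj, he]
    · simp [vecMulVec_apply, he, hi, hk i hi]
  have hdd : d ⬝ᵥ d ≤ 1 := by
    refine le_trans ?_ hD
    rw [frobInner_eq_sum]
    refine le_trans (le_of_eq ?_) (Finset.single_le_sum
      (f := fun i => ∑ j, (X - X') i j * (X - X') i j)
      (fun i _ => Finset.sum_nonneg fun j _ => mul_self_nonneg _) (Finset.mem_univ k))
    simp [dotProduct, hdj]
  have hW := frobInner_self_nonneg W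
  have hbound (t : ℝ) (ht : t ∈ Set.Icc (0 : ℝ) 1) :
      |∫ A : Matrix.orthogonalGroup (Fin n) ℝ, ((X - X') * Wᵀ * A.1).trace *
        Real.exp ((X' + t • (X - X')) * Wᵀ * A.1).trace ∂(uniformOrthogonal n)| ≤
        L * orbitIntegral (X' + t • (X - X')) W := by
    have htr (A : Matrix (Fin n) (Fin n) ℝ) :
        ((X - X') * Wᵀ * A).trace = e ⬝ᵥ ((W *ᵥ d) ᵥ* A) := by
      rw [hDe, vecMulVec_mul, vecMulVec_mul, trace_vecMulVec, vecMul_transpose]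
    simp only [htr]
    -- By convexity row k keeps its entries in [-1, 1] along the segment; this is the source of √p
    -- in `L`.
    have hrow : (e ᵥ* (X' + t • (X - X'))) ⬝ᵥ (e ᵥ* (X' + t • (X - X'))) ≤ p := by
      have hx (j : Fin p) : (e ᵥ* (X' + t • (X - X'))) j = (1 - t) * X' k j + t * X k j := by
        simp [he]
        ring
      have : ∀ j ∈ (Finset.univ : Finset (Fin p)),
          (e ᵥ* (X' + t • (X - X'))) j * (e ᵥ* (X' + t • (X - X'))) j ≤ 1 := by
        intro j _
        rw [hx, ← pow_two, sq_le_one_iff_abs_le_one]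
        have h1 := abs_le.mp (hX k j)
        have h2 := abs_le.mp (hX' k j)
        have ht' : 0 ≤ 1 - t := by linarith [ht.2]
        rw [abs_le]
        constructor <;> nlinarith [ht.1]
      simpa [dotProduct] using Finset.sum_le_sum this
    have h := abs_integral_langevin_le (X' + t • (X - X')) W hnp e (W *ᵥ d)
      (a := √(frobInner W W)) (b := √(frobInner W W) * √p) (Real.sqrt_nonneg _) (by positivity)
      (by
        rw [Real.sq_sqrt hW]
        exact (mulVec_dotProduct_self_le W d).trans (mul_le_of_le_one_right hW hdd))
      (by
        rw [mul_pow, Real.sq_sqrt hW, Real.sq_sqrt (Nat.cast_nonneg p)]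
        exact (mulVec_dotProduct_self_le W _).trans (mul_le_mul_of_nonneg_left hrow hW))
    rw [← mul_assoc, Real.mul_self_sqrt hW] at h
    rw [orbitIntegral_eq]
    exact h
  -- Mean value inequality for the logarithm of the orbital integral.
  have hmain := norm_image_sub_le_of_norm_deriv_le_segment'
    (f := fun t : ℝ => Real.log (orbitIntegral (X' + t • (X - X')) W)) (a := 0) (b := 1) (C := L)
    (fun t _ => ((hasDerivAt_orbitIntegral X' (X - X') W t).log
      (orbitIntegral_pos _ _).ne').hasDerivWithinAt)
    (fun t ht => by
      rw [Real.norm_eq_abs, abs_div, abs_of_pos (orbitIntegral_pos _ _),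
        div_le_iff₀ (orbitIntegral_pos _ _)]
      exact hbound t (Set.Ico_subset_Icc_self ht))
    1 (Set.right_mem_Icc.mpr zero_le_one)
  simp only [one_smul, zero_smul, add_zero, sub_zero, mul_one, add_sub_cancel] at hmain
  have h1 := (le_abs_self _).trans hmain
  rw [← Real.log_le_log_iff (orbitIntegral_pos _ _)
    (mul_pos (Real.exp_pos _) (orbitIntegral_pos _ _)), Real.log_mul (Real.exp_pos _).ne'
    (orbitIntegral_pos _ _).ne', Real.log_exp]
  linarith

end OrbitIntegral

/-! ### Gaussian matrices through characteristic functions -/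

section GaussianNoise

variable {n p : ℕ}

lemma measurable_matrix_of : Measurable
    (Matrix.of : (Fin n → Fin p → ℝ) ≃ Matrix (Fin n) (Fin p) ℝ) := measurable_id

instance noiseLaw_isProbabilityMeasure (n p : ℕ) (σ : ℝ) :
    IsProbabilityMeasure (noiseLaw n p σ) := by
  unfold noiseLaw
  exact Measure.isProbabilityMeasure_map measurable_matrix_of.aemeasurable

/-- Finite measures on matrices are determined by their characteristic functions. -/
lemma ext_of_integral_frobInner {P P' : Measure (Matrix (Fin n) (Fin p) ℝ)} [IsFiniteMeasure P]
    [IsFiniteMeasure P']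
    (h : ∀ T, ∫ C, Complex.exp (frobInner C T * Complex.I) ∂P =
      ∫ C, Complex.exp (frobInner C T * Complex.I) ∂P') : P = P' := by
  let L : (Fin n → Fin p → ℝ) →ₗ[ℝ] Matrix (Fin n) (Fin p) ℝ →ₗ[ℝ] ℝ :=
    LinearMap.mk₂ ℝ (fun X Y => frobInner (Matrix.of X) Y)
      (fun X Y Z => frobInner_add_left (Matrix.of X) (Matrix.of Y) Z)
      (fun c X Y => frobInner_smul_left c (Matrix.of X) Y)
      (fun X Y Z => frobInner_add_right (Matrix.of X) Y Z)
      (fun c X Y => frobInner_smul_right c (Matrix.of X) Y)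
  have hL : Continuous fun z : (Fin n → Fin p → ℝ) × Matrix (Fin n) (Fin p) ℝ => L z.1 z.2 :=
    continuous_frobInner
  refine @ext_of_integral_char_eq (Matrix (Fin n) (Fin p) ℝ) _ _ _ Real.probChar
    (Fin n → Fin p → ℝ) _ _ _ _ _ _ _ L Real.continuous_probChar Real.probChar_ne_one ?_ hL
    P P' ‹_› ‹_› h
  intro X hX h0
  exact hX (frobInner_self_eq_zero (LinearMap.congr_fun h0 (Matrix.of X)))

lemma integral_exp_gaussianReal (v : NNReal) (t : ℝ) :
    ∫ x : ℝ, Complex.exp (((x * t : ℝ) : ℂ) * Complex.I) ∂(gaussianReal 0 v) =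
      Complex.exp (-((v * t ^ 2 / 2 : ℝ) : ℂ)) := by
  have h := charFun_gaussianReal (μ := 0) (v := v) t
  rw [charFun_apply_real] at h
  push_cast
  simpa [mul_comm] using h

lemma noiseLaw_charFun (σ : ℝ) (T : Matrix (Fin n) (Fin p) ℝ) :
    ∫ C, Complex.exp (frobInner C T * Complex.I) ∂(noiseLaw n p σ) =
      Complex.exp (-((σ ^ 2 * frobInner T T / 2 : ℝ) : ℂ)) := by
  unfold noiseLaw
  rw [integral_map measurable_matrix_of.aemeasurable
    (by
      have : Continuous fun C : Matrix (Fin n) (Fin p) ℝ =>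
          Complex.exp (frobInner C T * Complex.I) := by
        unfold frobInner
        fun_prop
      exact this.aestronglyMeasurable)]
  have h1 (x : Fin n → Fin p → ℝ) : Complex.exp (frobInner (Matrix.of x) T * Complex.I) =
      ∏ i, ∏ j, Complex.exp (((x i j * T i j : ℝ) : ℂ) * Complex.I) := by
    simp only [← Complex.exp_sum, frobInner_eq_sum, Complex.ofReal_sum, Finset.sum_mul,
      Matrix.of_apply]
  simp only [h1]
  rw [integral_fintype_prod_eq_prod (fun i (r : Fin p → ℝ) =>
    ∏ j, Complex.exp (((r j * T i j : ℝ) : ℂ) * Complex.I))]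
  have h2 (i : Fin n) : ∫ r : Fin p → ℝ, ∏ j, Complex.exp (((r j * T i j : ℝ) : ℂ) * Complex.I)
      ∂(Measure.pi fun _ : Fin p => gaussianReal 0 (Real.toNNReal (σ ^ 2))) =
      ∏ j, Complex.exp (-((σ ^ 2 * T i j ^ 2 / 2 : ℝ) : ℂ)) := by
    rw [integral_fintype_prod_eq_prod (fun j (c : ℝ) =>
      Complex.exp (((c * T i j : ℝ) : ℂ) * Complex.I))]
    simp only [integral_exp_gaussianReal, Real.coe_toNNReal _ (sq_nonneg σ)]
  simp only [h2]
  simp only [← Complex.exp_sum, frobInner_eq_sum, ← Complex.ofReal_neg, ← Complex.ofReal_sum,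
    Finset.mul_sum, Finset.sum_div, Finset.sum_neg_distrib, pow_two]

lemma measurable_mul_const_left (A : Matrix (Fin n) (Fin n) ℝ) :
    Measurable fun C : Matrix (Fin n) (Fin p) ℝ => A * C :=
  (show Continuous fun C : Matrix (Fin n) (Fin p) ℝ => A * C by fun_prop).measurable

/-- Gaussian noise is invariant under orthogonal transformations. -/
lemma noiseLaw_map_orthogonal (σ : ℝ) (A : Matrix.orthogonalGroup (Fin n) ℝ) :
    (noiseLaw n p σ).map (fun C => (A : Matrix (Fin n) (Fin n) ℝ) * C) = noiseLaw n p σ := by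
  have := Measure.isProbabilityMeasure_map (μ := noiseLaw n p σ)
    (measurable_mul_const_left (A : Matrix (Fin n) (Fin n) ℝ)).aemeasurable
  refine ext_of_integral_frobInner fun T => ?_
  rw [integral_map (measurable_mul_const_left _).aemeasurable
    (by
      have : Continuous fun C : Matrix (Fin n) (Fin p) ℝ =>
          Complex.exp (frobInner C T * Complex.I) := by
        unfold frobInner
        fun_prop
      exact this.aestronglyMeasurable)]
  simp only [frobInner_mul_left A.1, noiseLaw_charFun]
  -- The inverse of A is definitionally its transpose, so the norm of Aᵀ T is that of T.
  rw [← frobInner_orthogonal_mul A⁻¹ T T]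
  rfl

lemma measurable_frobInner_right (D : Matrix (Fin n) (Fin p) ℝ) :
    Measurable fun C : Matrix (Fin n) (Fin p) ℝ => frobInner D C :=
  (show Continuous fun C : Matrix (Fin n) (Fin p) ℝ => frobInner D C by
    unfold frobInner; fun_prop).measurable

/-- A linear functional of Gaussian noise is Gaussian. -/
lemma noiseLaw_map_frobInner (σ : ℝ) (D : Matrix (Fin n) (Fin p) ℝ) :
    (noiseLaw n p σ).map (fun C => frobInner D C) =
      (gaussianReal 0 1).map (fun z => σ * √(frobInner D D) * z) := by
  have := Measure.isProbabilityMeasure_map (μ := noiseLaw n p σ)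
    (measurable_frobInner_right D).aemeasurable
  rw [gaussianReal_map_const_mul]
  refine Measure.ext_of_charFun ?_
  ext t
  rw [charFun_gaussianReal, charFun_apply_real, integral_map
    (measurable_frobInner_right D).aemeasurable
    (by
      have : Continuous fun x : ℝ => Complex.exp (t * x * Complex.I) := by fun_prop
      exact this.aestronglyMeasurable)]
  have h := noiseLaw_charFun σ (t • D)
  simp only [frobInner_smul_right, frobInner_smul_left] at h
  simp only [frobInner_comm D]
  push_cast at h
  rw [h]
  congr 1
  have hs : ((√(frobInner D D) : ℝ) : ℂ) ^ 2 = (frobInner D D : ℝ) := by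
    rw [← Complex.ofReal_pow, Real.sq_sqrt (frobInner_self_nonneg D)]
  simp [mul_pow, hs]
  ring

/-- Gaussian noise, built from `n * p` independent standard Gaussian variables. -/
lemma noiseLaw_eq_map_pi (n p : ℕ) (σ : ℝ) :
    noiseLaw n p σ = (Measure.pi fun _ : Fin (n * p) => gaussianReal 0 1).map
      (fun z => Matrix.of fun i j => σ * z (finProdFinEquiv (i, j))) := by
  have hm : Continuous (fun z : Fin (n * p) → ℝ =>
      (Matrix.of fun i j => σ * z (finProdFinEquiv (i, j)) : Matrix (Fin n) (Fin p) ℝ)) := by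
    fun_prop
  have := Measure.isProbabilityMeasure_map
    (μ := Measure.pi fun _ : Fin (n * p) => gaussianReal 0 1) hm.measurable.aemeasurable
  refine ext_of_integral_frobInner fun T => ?_
  rw [integral_map hm.measurable.aemeasurable
    (by
      have : Continuous fun C : Matrix (Fin n) (Fin p) ℝ =>
          Complex.exp (frobInner C T * Complex.I) := by
        unfold frobInner
        fun_prop
      exact this.aestronglyMeasurable), noiseLaw_charFun]
  have h1 (z : Fin (n * p) → ℝ) : Complex.exp (frobInner
      (Matrix.of fun i j => σ * z (finProdFinEquiv (i, j))) T * Complex.I) =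
      ∏ k, Complex.exp (((z k * (σ * T (finProdFinEquiv.symm k).1 (finProdFinEquiv.symm k).2) : ℝ)
        : ℂ) * Complex.I) := by
    rw [← Complex.exp_sum, ← Finset.sum_mul, ← Complex.ofReal_sum, frobInner_eq_sum,
      ← Finset.sum_product', ← Equiv.sum_comp finProdFinEquiv]
    simp only [Matrix.of_apply, Equiv.symm_apply_apply, Finset.univ_product_univ]
    congr 4
    ext x
    ring
  simp only [h1]
  rw [integral_fintype_prod_eq_prod (fun k (c : ℝ) => Complex.exp (((c * (σ * T
    (finProdFinEquiv.symm k).1 (finProdFinEquiv.symm k).2) : ℝ) : ℂ) * Complex.I))]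
  simp only [integral_exp_gaussianReal]
  rw [← Complex.exp_sum, ← Equiv.sum_comp finProdFinEquiv, frobInner_eq_sum,
    ← Finset.sum_product']
  simp only [Equiv.symm_apply_apply, Finset.univ_product_univ, ← Complex.ofReal_neg,
    ← Complex.ofReal_sum]
  congr 2
  rw [Finset.mul_sum, Finset.sum_div, ← Finset.sum_neg_distrib]
  refine Finset.sum_congr rfl fun x _ => ?_
  simp only [NNReal.coe_one]
  ring

lemma noiseLaw_map_frobInner_self (n p : ℕ) (σ : ℝ) :
    (noiseLaw n p σ).map (fun C => frobInner C C) =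
      (chiSquared (n * p)).map (fun c => σ ^ 2 * c) := by
  have hm : Continuous (fun z : Fin (n * p) → ℝ =>
      (Matrix.of fun i j => σ * z (finProdFinEquiv (i, j)) : Matrix (Fin n) (Fin p) ℝ)) := by
    fun_prop
  have hf : Continuous fun C : Matrix (Fin n) (Fin p) ℝ => frobInner C C := by
    unfold frobInner
    fun_prop
  rw [noiseLaw_eq_map_pi, chiSquared, Measure.map_map hf.measurable hm.measurable,
    Measure.map_map (by fun_prop) (by fun_prop)]
  congr 1
  ext z
  simp only [Function.comp_apply, frobInner_eq_sum, Matrix.of_apply]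
  rw [← Finset.sum_product', ← Equiv.sum_comp finProdFinEquiv, Finset.univ_product_univ,
    Finset.mul_sum]
  exact Finset.sum_congr rfl fun x _ => by ring

end GaussianNoise

/-! ### Densities of shifted Gaussian noise -/

section WithDensity

/-- A product of probability measures with densities has the product density. -/
lemma pi_withDensity {ι : Type*} [Fintype ι] {Ω : ι → Type*} [∀ i, MeasurableSpace (Ω i)]
    (μ : ∀ i, Measure (Ω i)) [∀ i, IsProbabilityMeasure (μ i)] {f : ∀ i, Ω i → ENNReal}
    (hf : ∀ i, Measurable (f i)) [∀ i, SigmaFinite ((μ i).withDensity (f i))] :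
    Measure.pi (fun i => (μ i).withDensity (f i)) =
      (Measure.pi μ).withDensity (fun x => ∏ i, f i (x i)) := by
  classical
  refine Measure.pi_eq fun s hs => ?_
  rw [withDensity_apply _ (MeasurableSet.univ_pi hs),
    ← lintegral_indicator (MeasurableSet.univ_pi hs)]
  have hind : (Set.univ.pi s).indicator (fun x => ∏ i, f i (x i)) =
      fun x : ∀ i, Ω i => ∏ i, (s i).indicator (f i) (x i) := by
    ext x
    by_cases hx : x ∈ Set.univ.pi s
    · rw [Set.indicator_of_mem hx]
      exact Finset.prod_congr rfl fun i _ => (Set.indicator_of_mem (hx i (Set.mem_univ i)) _).symm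
    · rw [Set.indicator_of_notMem hx]
      simp only [Set.mem_pi, Set.mem_univ, true_implies, not_forall] at hx
      obtain ⟨i, hi⟩ := hx
      exact (Finset.prod_eq_zero (Finset.mem_univ i) (Set.indicator_of_notMem hi _)).symm
  have hm (i : ι) : Measurable ((s i).indicator (f i)) := (hf i).indicator (hs i)
  have hmp : ∀ i, MeasurePreserving (Function.eval i) (Measure.pi μ) (μ i) :=
    fun i => measurePreserving_eval μ i
  rw [hind, lintegral_prod_eq_prod_lintegral_of_indepFun Finset.univ
    (fun i (x : ∀ i, Ω i) => (s i).indicator (f i) (x i))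
    (iIndepFun_pi fun i => (hm i).aemeasurable) fun i => (hm i).comp (measurable_pi_apply i)]
  refine Finset.prod_congr rfl fun i _ => ?_
  rw [withDensity_apply _ (hs i), ← lintegral_indicator (hs i)]
  exact (hmp i).lintegral_comp (hm i)

lemma gaussianReal_eq_withDensity (m : ℝ) {v : NNReal} (hv : v ≠ 0) :
    gaussianReal m v = (gaussianReal 0 v).withDensity
      (fun x => ENNReal.ofReal (Real.exp ((m * x - m ^ 2 / 2) / v))) := by
  rw [gaussianReal_of_var_ne_zero m hv, gaussianReal_of_var_ne_zero 0 hv,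
    ← withDensity_mul _ (measurable_gaussianPDF 0 v) (by fun_prop)]
  congr 1
  ext x
  have hv' : (v : ℝ) ≠ 0 := by exact_mod_cast hv
  rw [Pi.mul_apply, gaussianPDF, gaussianPDF, ← ENNReal.ofReal_mul (gaussianPDFReal_nonneg _ _ _),
    gaussianPDFReal, gaussianPDFReal, mul_assoc (√(2 * Real.pi * v))⁻¹, ← Real.exp_add]
  congr 3
  field_simp
  ring

variable {n p : ℕ}

/-- The Radon–Nikodym density of `N(X, σ²)` with respect to `N(0, σ²)`. -/
noncomputable def shiftDensity (σ : ℝ) (X Y : Matrix (Fin n) (Fin p) ℝ) : ENNReal :=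
  ENNReal.ofReal (Real.exp ((frobInner X Y - frobInner X X / 2) / σ ^ 2))

/-- The one-dimensional density ratio is multiplied over the entries, first within each row and then
over the rows, following the nested product measure. -/
lemma noiseLaw_map_add {σ : ℝ} (hσ : 0 < σ) (X : Matrix (Fin n) (Fin p) ℝ) :
    (noiseLaw n p σ).map (fun C => X + C) = (noiseLaw n p σ).withDensity (shiftDensity σ X) := by
  have hσ2 : (0 : ℝ) < σ ^ 2 := by positivity
  set v : NNReal := Real.toNNReal (σ ^ 2) with hv
  have hv0 : v ≠ 0 := (Real.toNNReal_pos.mpr hσ2).ne'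
  have hvσ : (v : ℝ) = σ ^ 2 := Real.coe_toNNReal _ hσ2.le
  have hγ : (noiseLaw n p σ) = (Measure.pi fun _ : Fin n => Measure.pi fun _ : Fin p =>
    gaussianReal 0 v) := Measure.map_id
  set f : Fin n → Fin p → ℝ → ENNReal := fun i j x =>
    ENNReal.ofReal (Real.exp ((X i j * x - X i j ^ 2 / 2) / v)) with hf
  have hfm (i : Fin n) (j : Fin p) : Measurable (f i j) := by fun_prop
  have hg (i : Fin n) (j : Fin p) :
      (gaussianReal 0 v).map (fun x => X i j + x) = (gaussianReal 0 v).withDensity (f i j) := by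
    rw [gaussianReal_map_const_add, zero_add, gaussianReal_eq_withDensity _ hv0]
  have hgp (i : Fin n) (j : Fin p) :
      IsProbabilityMeasure ((gaussianReal 0 v).withDensity (f i j)) := by
    rw [← hg]
    exact Measure.isProbabilityMeasure_map (by fun_prop)
  have hrow (i : Fin n) : (Measure.pi fun _ : Fin p => gaussianReal 0 v).map
      (fun r j => X i j + r j) = (Measure.pi fun _ : Fin p => gaussianReal 0 v).withDensity
        (fun r => ∏ j, f i j (r j)) := by
    have : ∀ j, IsProbabilityMeasure ((gaussianReal 0 v).map (fun x => X i j + x)) := fun j =>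
      Measure.isProbabilityMeasure_map (by fun_prop)
    rw [Measure.pi_map_pi (μ := fun _ : Fin p => gaussianReal 0 v)
      (f := fun j x => X i j + x) (fun j => by fun_prop)]
    simp only [hg]
    exact pi_withDensity _ (hfm i)
  have hrm (i : Fin n) : Measurable fun r : Fin p → ℝ => ∏ j, f i j (r j) :=
    Finset.measurable_prod _ fun j _ => (hfm i j).comp (measurable_pi_apply j)
  have hadd (i : Fin n) : Measurable fun (r : Fin p → ℝ) j => X i j + r j :=
    measurable_pi_lambda _ fun j => Measurable.add (f := fun _ : Fin p → ℝ => X i j) measurable_const (measurable_pi_apply j)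
  have hmap (i : Fin n) : IsProbabilityMeasure ((Measure.pi fun _ : Fin p => gaussianReal 0 v).map
      (fun r j => X i j + r j)) := Measure.isProbabilityMeasure_map (hadd i).aemeasurable
  have hmap' (i : Fin n) : IsProbabilityMeasure
      ((Measure.pi fun _ : Fin p => gaussianReal 0 v).withDensity
        (fun r => ∏ j, f i j (r j))) := by
    rw [← hrow]
    exact hmap i
  have hall := Measure.pi_map_pi (μ := fun _ : Fin n => Measure.pi fun _ : Fin p =>
      gaussianReal 0 v) (f := fun i r j => X i j + r j) (fun i => (hadd i).aemeasurable)
  simp only [hrow] at hall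
  rw [pi_withDensity _ hrm] at hall
  rw [hγ]
  have hdens : (fun x : Fin n → Fin p → ℝ => ∏ i, ∏ j, f i j (x i j)) = shiftDensity σ X := by
    funext x
    change _ = ENNReal.ofReal (Real.exp ((frobInner X (Matrix.of x) - frobInner X X / 2) / σ ^ 2))
    simp only [hf, ← hvσ]
    simp only [← ENNReal.ofReal_prod_of_nonneg fun _ _ => (Real.exp_pos _).le]
    rw [← ENNReal.ofReal_prod_of_nonneg fun _ _ =>
      Finset.prod_nonneg fun _ _ => (Real.exp_pos _).le]
    simp only [← Real.exp_sum, frobInner_eq_sum]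
    congr 2
    simp only [← Finset.sum_div, Finset.sum_sub_distrib, pow_two, Matrix.of_apply]
  rw [← hdens]
  exact hall

end WithDensity

/-! ### Upper quantiles -/

section Quantile

lemma measure_Ioi_le_iff (μ : Measure ℝ) [IsProbabilityMeasure μ] {δ : ℝ} (hδ : 0 ≤ δ) (t : ℝ) :
    μ (Set.Ioi t) ≤ ENNReal.ofReal δ ↔ 1 - δ ≤ cdf μ t := by
  have h : μ.real (Set.Ioi t) = 1 - cdf μ t := by
    rw [← Set.compl_Iic, probReal_compl_eq_one_sub measurableSet_Iic, cdf_eq_real]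
  rw [← ofReal_measureReal (measure_ne_top μ _), ENNReal.ofReal_le_ofReal_iff hδ, h]
  constructor <;> intro h <;> linarith

/-- Every point to the right of the infimum satisfies the tail bound, and right continuity of the
distribution function passes it to the infimum itself. -/
lemma measure_Ioi_upperQuantile_le (μ : Measure ℝ) [IsProbabilityMeasure μ] {δ : ℝ} (hδ₀ : 0 < δ) :
    μ (Set.Ioi (upperQuantile μ δ)) ≤ ENNReal.ofReal δ := by
  have hS : {t : ℝ | μ (Set.Ioi t) ≤ ENNReal.ofReal δ} = {t | 1 - δ ≤ cdf μ t} :=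
    Set.ext fun t => measure_Ioi_le_iff μ hδ₀.le t
  rw [measure_Ioi_le_iff μ hδ₀.le, upperQuantile, hS]
  set S := {t | 1 - δ ≤ cdf μ t} with hSdef
  have hne : S.Nonempty := by
    have := ((tendsto_cdf_atTop μ).eventually (lt_mem_nhds (sub_lt_self 1 hδ₀))).exists
    obtain ⟨t, ht⟩ := this
    exact ⟨t, ht.le⟩
  have hr := (cdf μ).right_continuous (sInf S)
  refine ge_of_tendsto (hr.tendsto.mono_left (nhdsWithin_mono _ Set.Ioi_subset_Ici_self)) ?_
  filter_upwards [self_mem_nhdsWithin] with t ht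
  obtain ⟨s, hs, hst⟩ := exists_lt_of_csInf_lt hne ht
  exact le_trans hs (monotone_cdf μ hst.le)

lemma gaussianReal_Ioi_zero : gaussianReal 0 1 (Set.Ioi 0) = ENNReal.ofReal (1 / 2) := by
  have hsymm : gaussianReal 0 1 (Set.Iio 0) = gaussianReal 0 1 (Set.Ioi 0) := by
    conv_rhs => rw [← neg_zero, ← gaussianReal_map_neg]
    rw [Measure.map_apply measurable_neg measurableSet_Ioi]
    simp
  have : NullSingletonClass (gaussianReal 0 1) := nullSingletonClass_gaussianReal one_ne_zero
  have hadd : (gaussianReal 0 1).real (Set.Iic 0) + (gaussianReal 0 1).real (Set.Ioi 0) = 1 := by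
    rw [← Set.compl_Iic, probReal_compl_eq_one_sub measurableSet_Iic]
    ring
  have hIic : (gaussianReal 0 1).real (Set.Iic 0) = (gaussianReal 0 1).real (Set.Ioi 0) := by
    rw [measureReal_def, measureReal_def, ← hsymm, measure_congr Iio_ae_eq_Iic]
  rw [← ofReal_measureReal (measure_ne_top _ _)]
  congr 1
  linarith

lemma gaussianQuantile_pos {δ : ℝ} (hδ₀ : 0 < δ) (hδ₁ : δ < 1 / 2) : 0 < gaussianQuantile δ := by
  by_contra! h
  have h1 := measure_Ioi_upperQuantile_le (gaussianReal 0 1) hδ₀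
  have h2 := (measure_mono (Set.Ioi_subset_Ioi h)).trans h1
  rw [gaussianReal_Ioi_zero, ENNReal.ofReal_le_ofReal_iff hδ₀.le] at h2
  linarith

instance chiSquared_isProbabilityMeasure (k : ℕ) : IsProbabilityMeasure (chiSquared k) :=
  Measure.isProbabilityMeasure_map
    (show Measurable fun z : Fin k → ℝ => ∑ i, z i ^ 2 by fun_prop).aemeasurable

end Quantile

/-! ### The Gaussian mechanism and the law of the masked release -/

section Mechanisms

variable {n p : ℕ}

/-- An approximate density bound: `μ ≤ c μ'` on a set whose complement has `μ`-measure at most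
`d`. -/
lemma measure_le_of_good_set {α : Type*} [MeasurableSpace α] {μ μ' : Measure α} {c d : ENNReal}
    {G : Set α} (hG : MeasurableSet G) (hd : μ Gᶜ ≤ d)
    (h : ∀ T ⊆ G, MeasurableSet T → μ T ≤ c * μ' T) {S : Set α} (hS : MeasurableSet S) :
    μ S ≤ c * μ' S + d := by
  rw [← measure_inter_add_sdiff S hG]
  refine add_le_add ?_ ((measure_mono fun x hx => hx.2).trans hd)
  exact (h _ Set.inter_subset_right (hS.inter hG)).trans
    (mul_le_mul_right (measure_mono Set.inter_subset_left) c)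

lemma measurable_const_add_matrix (X : Matrix (Fin n) (Fin p) ℝ) :
    Measurable fun C : Matrix (Fin n) (Fin p) ℝ => X + C :=
  (show Continuous fun C : Matrix (Fin n) (Fin p) ℝ => X + C by fun_prop).measurable

lemma measurable_shiftDensity (σ : ℝ) (X : Matrix (Fin n) (Fin p) ℝ) :
    Measurable (shiftDensity σ X) :=
  (((measurable_frobInner_right X).sub_const _).div_const _).exp.ennreal_ofReal

/-- The Gaussian mechanism with unit sensitivity is differentially private. -/
lemma gaussian_mechanism {ε δ σ : ℝ} (hε : 0 < ε) (hδ₀ : 0 < δ) (hσ : 0 < σ)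
    (h : gaussianQuantile δ + 1 / (2 * σ) ≤ σ * ε) {X X' : Matrix (Fin n) (Fin p) ℝ}
    (hD : frobInner (X - X') (X - X') ≤ 1) {S : Set (Matrix (Fin n) (Fin p) ℝ)}
    (hS : MeasurableSet S) :
    (noiseLaw n p σ).map (fun C => X + C) S ≤
      ENNReal.ofReal (Real.exp ε) * (noiseLaw n p σ).map (fun C => X' + C) S +
        ENNReal.ofReal δ := by
  have hσ2 : (0 : ℝ) < σ ^ 2 := by positivity
  -- This is σ² times the log-likelihood ratio. At Y = X + C it equals ⟨X - X', C⟩ + r²/2 with r =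
  -- ‖X - X'‖, hence is Gaussian.
  set ℓ : Matrix (Fin n) (Fin p) ℝ → ℝ := fun Y =>
    (frobInner X Y - frobInner X X / 2) - (frobInner X' Y - frobInner X' X' / 2) with hℓ
  have hℓm : Measurable ℓ := ((measurable_frobInner_right X).sub_const _).sub
    ((measurable_frobInner_right X').sub_const _)
  refine measure_le_of_good_set (G := {Y | ℓ Y ≤ ε * σ ^ 2})
    (measurableSet_le hℓm measurable_const) ?_ ?_ hS
  · refine le_trans ?_ (measure_Ioi_upperQuantile_le (gaussianReal 0 1) hδ₀)
    rw [Measure.map_apply (measurable_const_add_matrix X)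
      (measurableSet_le hℓm measurable_const).compl]
    set r := √(frobInner (X - X') (X - X')) with hr
    have hr0 : 0 ≤ r := Real.sqrt_nonneg _
    have hr1 : r ≤ 1 := Real.sqrt_le_one.mpr hD
    have hrr : frobInner (X - X') (X - X') = r ^ 2 :=
      (Real.sq_sqrt (frobInner_self_nonneg _)).symm
    have hset : (fun C => X + C) ⁻¹' {Y | ℓ Y ≤ ε * σ ^ 2}ᶜ =
        (fun C => frobInner (X - X') C) ⁻¹' Set.Ioi (ε * σ ^ 2 - r ^ 2 / 2) := by
      ext C
      simp only [Set.mem_preimage, Set.mem_compl_iff, Set.mem_ofPred_eq, not_le, Set.mem_Ioi, hℓ,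
        ← hrr, frobInner_sub_left, frobInner_sub_right, frobInner_add_right, frobInner_comm X' X]
      constructor <;> intro h <;> linarith
    rw [hset, ← Measure.map_apply (measurable_frobInner_right _) measurableSet_Ioi,
      noiseLaw_map_frobInner, Measure.map_apply (by fun_prop) measurableSet_Ioi]
    refine measure_mono fun z hz => ?_
    simp only [Set.mem_preimage, Set.mem_Ioi, ← hr] at hz ⊢
    by_contra! hzq
    have hzq' : z ≤ gaussianQuantile δ := hzq
    have h1 : σ * z ≤ σ ^ 2 * ε - 1 / 2 := by
      have h2 : σ * (1 / (2 * σ)) = 1 / 2 := by field_simp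
      nlinarith
    -- The hypothesis is the case r = 1; smaller r only lowers the privacy loss.
    nlinarith [mul_le_mul_of_nonneg_left h1 hr0, mul_nonneg (sub_nonneg.mpr hr1) (mul_pos hε hσ2).le,
      mul_nonneg (sub_nonneg.mpr hr1) hr0]
  · intro T hT hTm
    rw [noiseLaw_map_add hσ, noiseLaw_map_add hσ, withDensity_apply _ hTm, withDensity_apply _ hTm,
      ← lintegral_const_mul _ (measurable_shiftDensity σ X')]
    refine setLIntegral_mono ((measurable_shiftDensity σ X').const_mul _) fun Y hY => ?_
    rw [shiftDensity, shiftDensity, ← ENNReal.ofReal_mul (Real.exp_pos _).le, ← Real.exp_add]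
    refine ENNReal.ofReal_le_ofReal (Real.exp_le_exp.mpr ?_)
    have hYG : ℓ Y ≤ ε * σ ^ 2 := hT hY
    rw [div_le_iff₀ hσ2, add_mul, div_mul_cancel₀ _ hσ2.ne']
    simp only [hℓ] at hYG
    linarith

lemma measurable_mechanismC_map (X : Matrix (Fin n) (Fin p) ℝ) :
    Measurable fun AC : Matrix.orthogonalGroup (Fin n) ℝ × Matrix (Fin n) (Fin p) ℝ =>
      (AC.1 : Matrix (Fin n) (Fin n) ℝ) * X + AC.2 :=
  (show Continuous fun AC : Matrix.orthogonalGroup (Fin n) ℝ × Matrix (Fin n) (Fin p) ℝ =>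
    (AC.1 : Matrix (Fin n) (Fin n) ℝ) * X + AC.2 by fun_prop).measurable

lemma measurable_mechanismB_map (X : Matrix (Fin n) (Fin p) ℝ) :
    Measurable fun AC : Matrix.orthogonalGroup (Fin n) ℝ × Matrix (Fin n) (Fin p) ℝ =>
      (AC.1 : Matrix (Fin n) (Fin n) ℝ) * (X + AC.2) :=
  (show Continuous fun AC : Matrix.orthogonalGroup (Fin n) ℝ × Matrix (Fin n) (Fin p) ℝ =>
    (AC.1 : Matrix (Fin n) (Fin n) ℝ) * (X + AC.2) by fun_prop).measurable

lemma mechanismC_apply (σ : ℝ) (X : Matrix (Fin n) (Fin p) ℝ)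
    {S : Set (Matrix (Fin n) (Fin p) ℝ)} (hS : MeasurableSet S) :
    mechanismC n p σ X S = ∫⁻ A : Matrix.orthogonalGroup (Fin n) ℝ,
      (noiseLaw n p σ).map (fun C => (A : Matrix (Fin n) (Fin n) ℝ) * X + C) S
        ∂(uniformOrthogonal n) := by
  rw [mechanismC, Measure.map_apply (measurable_mechanismC_map X) hS,
    Measure.prod_apply (measurable_mechanismC_map X hS)]
  refine lintegral_congr fun A => ?_
  rw [Measure.map_apply (measurable_const_add_matrix _) hS]
  rfl

/-- Rotating the noise does not change its law, so both maskings have the same law. -/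
lemma mechanismB_eq_mechanismC (σ : ℝ) (X : Matrix (Fin n) (Fin p) ℝ) :
    mechanismB n p σ X = mechanismC n p σ X := by
  ext S hS
  rw [mechanismC_apply σ X hS, mechanismB, Measure.map_apply (measurable_mechanismB_map X) hS,
    Measure.prod_apply (measurable_mechanismB_map X hS)]
  refine lintegral_congr fun A => ?_
  rw [← noiseLaw_map_orthogonal σ A, Measure.map_map (measurable_const_add_matrix _)
    (measurable_mul_const_left _), Measure.map_apply ((measurable_const_add_matrix _).comp
    (measurable_mul_const_left _)) hS, noiseLaw_map_orthogonal]
  congr 1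
  ext C
  simp [Matrix.mul_add]

/-- Tonelli integrates A out of the shifted density. Since ‖AX‖ = ‖X‖, the quadratic term leaves the
integral over A. -/
lemma mechanismC_apply_eq_setLIntegral {σ : ℝ} (hσ : 0 < σ) (X : Matrix (Fin n) (Fin p) ℝ)
    {S : Set (Matrix (Fin n) (Fin p) ℝ)} (hS : MeasurableSet S) :
    mechanismC n p σ X S = ∫⁻ Y in S, ENNReal.ofReal (Real.exp (-(frobInner X X / 2 / σ ^ 2)) *
      orbitIntegral X ((σ ^ 2)⁻¹ • Y)) ∂(noiseLaw n p σ) := by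
  rw [mechanismC_apply σ X hS]
  simp only [noiseLaw_map_add hσ, withDensity_apply _ hS]
  have hc : Continuous fun z : Matrix.orthogonalGroup (Fin n) ℝ × Matrix (Fin n) (Fin p) ℝ =>
      shiftDensity σ ((z.1 : Matrix (Fin n) (Fin n) ℝ) * X) z.2 := by
    unfold shiftDensity frobInner
    exact ENNReal.continuous_ofReal.comp (by fun_prop)
  rw [lintegral_lintegral_swap hc.measurable.aemeasurable]
  refine lintegral_congr fun Y => ?_
  rw [orbitIntegral, ← integral_const_mul, ofReal_integral_eq_lintegral_ofReal
    (integrable_uniformOrthogonal (by unfold frobInner; fun_prop))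
    (Filter.Eventually.of_forall fun A => by positivity)]
  refine lintegral_congr fun A => ?_
  rw [shiftDensity, frobInner_orthogonal_mul, frobInner_smul_right, ← Real.exp_add]
  congr 2
  ring

end Mechanisms

/-! ### Privacy under each of the two noise bounds -/

section Privacy

variable {n p : ℕ}

section

attribute [local instance] Matrix.frobeniusNormedAddCommGroup

lemma Neighbors.frobInner_sub_le {X X' : Matrix (Fin n) (Fin p) ℝ} (h : Neighbors X X') :
    frobInner (X - X') (X - X') ≤ 1 := by
  have h1 := h.2.2.1
  rw [Matrix.frobenius_norm_def] at h1
  have hs : ∑ i, ∑ j, ‖(X - X') i j‖ ^ (2 : ℝ) = frobInner (X - X') (X - X') := by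
    simp only [frobInner_eq_sum, Real.rpow_two, Real.norm_eq_abs, pow_two, abs_mul_abs_self]
  rw [hs, ← Real.sqrt_eq_rpow] at h1
  simpa using (Real.sqrt_le_iff.mp h1).2

end

lemma IsDataSet.frobInner_self_le {X : Matrix (Fin n) (Fin p) ℝ} (hX : IsDataSet X) :
    frobInner X X ≤ n * p := by
  rw [frobInner_eq_sum]
  have h : ∀ i ∈ (Finset.univ : Finset (Fin n)), ∑ j, X i j * X i j ≤ p := fun i _ => by
    have h1 : ∀ j ∈ (Finset.univ : Finset (Fin p)), X i j * X i j ≤ 1 := fun j _ => by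
      rw [← pow_two, sq_le_one_iff_abs_le_one]
      exact hX i j
    simpa using Finset.sum_le_sum h1
  simpa using Finset.sum_le_sum h

/-- The squared norms of neighboring data sets differ by at most `2 √p`. -/
lemma frobInner_self_sub_le {X X' : Matrix (Fin n) (Fin p) ℝ} (hX : IsDataSet X)
    (hX' : IsDataSet X') (hD : frobInner (X - X') (X - X') ≤ 1) {k : Fin n}
    (hk : ∀ i, i ≠ k → X i = X' i) :
    frobInner X' X' - frobInner X X ≤ 2 * √p := by
  have hrow (f : Fin n → ℝ) (hf : ∀ i, i ≠ k → f i = 0) : ∑ i, f i = f k :=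
    Finset.sum_eq_single k (fun i _ hi => hf i hi) (by simp)
  -- Difference of squares on row k, prepared for Cauchy–Schwarz: the first factor has norm at most
  -- 1, the second at most 2√p.
  have h1 : frobInner X' X' - frobInner X X = ∑ j, (X k j - X' k j) * -(X k j + X' k j) := by
    rw [frobInner_eq_sum, frobInner_eq_sum, ← Finset.sum_sub_distrib, hrow]
    · rw [← Finset.sum_sub_distrib]
      exact Finset.sum_congr rfl fun j _ => by ring
    · intro i hi
      rw [hk i hi, sub_self]
  have h2 : ∑ j, (X k j - X' k j) ^ 2 ≤ 1 := by
    refine le_trans (le_of_eq ?_) hD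
    rw [frobInner_eq_sum, hrow]
    · exact Finset.sum_congr rfl fun j _ => by rw [Matrix.sub_apply, pow_two]
    · intro i hi
      simp [hk i hi]
  have h3 : ∑ j, (-(X k j + X' k j)) ^ 2 ≤ 4 * p := by
    have h : ∀ j ∈ (Finset.univ : Finset (Fin p)), (-(X k j + X' k j)) ^ 2 ≤ 4 := fun j _ => by
      have ha := abs_le.mp (hX k j)
      have hb := abs_le.mp (hX' k j)
      nlinarith
    simpa [mul_comm] using Finset.sum_le_sum h
  rw [h1]
  refine le_of_abs_le (abs_le_of_sq_le_sq ?_ (by positivity))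
  calc _ ≤ _ := Finset.sum_mul_sq_le_sq_mul_sq Finset.univ _ _
    _ ≤ 1 * (4 * (p : ℝ)) := mul_le_mul h2 h3 (Finset.sum_nonneg fun _ _ => sq_nonneg _) zero_le_one
    _ = (2 * √p) ^ 2 := by rw [mul_pow, Real.sq_sqrt (Nat.cast_nonneg p)]; ring

/-- Multiplied by ε, the bound reads γ + 1/(2γ) ≤ σε. As ε < 1 this forces σ ≥ γ, so 1/(2γ) may be
replaced by 1/(2σ). -/
lemma unmaskedBound_le_imp {ε δ σ : ℝ} (hε₀ : 0 < ε) (hε₁ : ε < 1) (hγ : 0 < gaussianQuantile δ)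
    (h : unmaskedBound ε δ ≤ σ) :
    0 < σ ∧ gaussianQuantile δ + 1 / (2 * σ) ≤ σ * ε := by
  rw [unmaskedBound] at h
  set γ := gaussianQuantile δ
  have h1 : γ + 1 / (2 * γ) ≤ σ * ε := by
    have h2 := mul_le_mul_of_nonneg_right h hε₀.le
    have h3 : γ / ε * (1 + 1 / (2 * γ ^ 2)) * ε = γ + 1 / (2 * γ) := by field_simp
    rwa [h3] at h2
  have hpos : 0 < 1 / (2 * γ) := by positivity
  have hσ : 0 < σ := pos_of_mul_pos_left (by linarith : 0 < σ * ε) hε₀.le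
  have hγσ : γ ≤ σ := by nlinarith
  refine ⟨hσ, le_trans ?_ h1⟩
  gcongr

lemma mechanismC_private_of_unmaskedBound {ε δ σ : ℝ} (hε₀ : 0 < ε) (hε₁ : ε < 1)
    (hδ₀ : 0 < δ) (hδ₁ : δ < 1 / 2) (h : unmaskedBound ε δ ≤ σ) :
    IsDifferentiallyPrivate (mechanismC n p σ) ε δ := by
  obtain ⟨hσ, hγ⟩ := unmaskedBound_le_imp hε₀ hε₁ (gaussianQuantile_pos hδ₀ hδ₁) h
  intro X X' hXX' S hS
  have hmeas : AEMeasurable (fun A : Matrix.orthogonalGroup (Fin n) ℝ =>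
      ENNReal.ofReal δ) (uniformOrthogonal n) := aemeasurable_const
  rw [mechanismC_apply σ X hS, mechanismC_apply σ X' hS]
  calc _ ≤ ∫⁻ A : Matrix.orthogonalGroup (Fin n) ℝ, (ENNReal.ofReal (Real.exp ε) *
        (noiseLaw n p σ).map (fun C => (A : Matrix (Fin n) (Fin n) ℝ) * X' + C) S +
          ENNReal.ofReal δ) ∂(uniformOrthogonal n) := by
        refine lintegral_mono fun A => gaussian_mechanism hε₀ hδ₀ hσ hγ ?_ hS
        rw [← Matrix.mul_sub, frobInner_orthogonal_mul]
        exact hXX'.frobInner_sub_le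
    _ = _ := by
        rw [lintegral_add_right' _ hmeas, lintegral_const, measure_univ, mul_one,
          lintegral_const_mul' _ _ ENNReal.ofReal_ne_top]

/-- The square root strictly exceeds |b|, so the sign of b is irrelevant. -/
lemma maskedVarianceBound_pos (hp : 0 < p) (hnp : p < n) {ε : ℝ} (hε : 0 < ε) (δ : ℝ) :
    0 < maskedVarianceBound n p ε δ := by
  have hd : (0 : ℝ) < n - p := sub_pos.mpr (by exact_mod_cast hnp)
  have hp' : (0 : ℝ) < p := by exact_mod_cast hp
  have hn' : (0 : ℝ) < n := by exact_mod_cast hp.trans hnp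
  rw [maskedVarianceBound]
  set b := maskedCoeff n p δ
  have hlt : |b| < √(b ^ 2 + 8 * n * p ^ 2 * ((n : ℝ) - p) * ε) := by
    rw [← Real.sqrt_sq_eq_abs]
    refine Real.sqrt_lt_sqrt (sq_nonneg b) (lt_add_of_pos_right _ (by positivity))
  have := neg_abs_le b
  exact div_pos (by linarith) (by positivity)

/-- Cleared of denominators, the claim is (n - p)ε s² - b s - 2np² ≥ 0, and the variance bound is
the larger root of this quadratic. -/
lemma privacy_loss_le (hnp : p < n) {ε δ s : ℝ} (hε : 0 < ε) (hs : 0 < s)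
    (h : maskedVarianceBound n p ε δ ≤ s) :
    (2 * (n * p) + 2 * (s * chiSquaredQuantile δ (n * p))) / s ^ 2 * p / ((n : ℝ) - p) +
      √p / s ≤ ε := by
  have hd : (0 : ℝ) < n - p := sub_pos.mpr (by exact_mod_cast hnp)
  rw [maskedVarianceBound] at h
  set b := maskedCoeff n p δ with hb
  set Δ := b ^ 2 + 8 * n * p ^ 2 * ((n : ℝ) - p) * ε with hΔ
  have hΔ0 : 0 ≤ Δ := by positivity
  rw [div_le_iff₀ (by positivity)] at h
  have h1 : Δ ≤ (s * (2 * ((n : ℝ) - p) * ε) - b) ^ 2 := by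
    rw [← Real.sq_sqrt hΔ0]
    exact pow_le_pow_left₀ (Real.sqrt_nonneg Δ) (by linarith) 2
  have h2 : b * s + 2 * n * p ^ 2 ≤ ((n : ℝ) - p) * ε * s ^ 2 := by
    have h3 : 0 ≤ 4 * (((n : ℝ) - p) * ε) *
        (((n : ℝ) - p) * ε * s ^ 2 - b * s - 2 * n * p ^ 2) := by
      rw [hΔ] at h1
      nlinarith
    have h4 := nonneg_of_mul_nonneg_right h3 (by positivity)
    linarith
  rw [maskedCoeff] at hb
  have h5 : (2 * (n * p) + 2 * (s * chiSquaredQuantile δ (n * p))) / s ^ 2 * p / ((n : ℝ) - p) +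
      √p / s = (b * s + 2 * n * p ^ 2) / (((n : ℝ) - p) * s ^ 2) := by
    rw [hb]
    field_simp
    ring
  rw [h5, div_le_iff₀ (by positivity)]
  linarith

/-- For each A, ‖AX + C‖² ≤ 2‖X‖² + 2‖C‖² with ‖X‖² ≤ np, so a large output forces ‖C‖² beyond σ²
times the χ² quantile. -/
lemma mechanismC_large_norm_le {δ σ : ℝ} (hδ₀ : 0 < δ)
    {X : Matrix (Fin n) (Fin p) ℝ} (hX : IsDataSet X) :
    mechanismC n p σ X {Y | frobInner Y Y ≤
      2 * (n * p) + 2 * (σ ^ 2 * chiSquaredQuantile δ (n * p))}ᶜ ≤ ENNReal.ofReal δ := by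
  have hm : Measurable fun C : Matrix (Fin n) (Fin p) ℝ => frobInner C C :=
    (show Continuous fun C : Matrix (Fin n) (Fin p) ℝ => frobInner C C by
      unfold frobInner; fun_prop).measurable
  have hG := (measurableSet_le hm (measurable_const
    (a := 2 * ((n : ℝ) * p) + 2 * (σ ^ 2 * chiSquaredQuantile δ (n * p))))).compl
  rw [mechanismC_apply σ X hG]
  calc _ ≤ ∫⁻ _ : Matrix.orthogonalGroup (Fin n) ℝ, ENNReal.ofReal δ ∂(uniformOrthogonal n) := by
        refine lintegral_mono fun A => ?_
        refine le_trans ?_ (measure_Ioi_upperQuantile_le (chiSquared (n * p)) hδ₀)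
        change (noiseLaw n p σ).map _ _ ≤ _
        rw [Measure.map_apply (measurable_const_add_matrix _) hG]
        calc _ ≤ (noiseLaw n p σ) ((fun C => frobInner C C) ⁻¹'
              Set.Ioi (σ ^ 2 * chiSquaredQuantile δ (n * p))) := by
              refine measure_mono fun C hC => ?_
              have hC' : 2 * ((n : ℝ) * p) + 2 * (σ ^ 2 * chiSquaredQuantile δ (n * p)) <
                  frobInner ((A : Matrix (Fin n) (Fin n) ℝ) * X + C)
                    ((A : Matrix (Fin n) (Fin n) ℝ) * X + C) := not_le.mp hC
              have h1 := frobInner_add_self_le ((A : Matrix (Fin n) (Fin n) ℝ) * X) C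
              rw [frobInner_orthogonal_mul] at h1
              have h2 := hX.frobInner_self_le
              simp only [Set.mem_preimage, Set.mem_Ioi]
              linarith
          _ ≤ chiSquared (n * p) (Set.Ioi (chiSquaredQuantile δ (n * p))) := by
              rw [← Measure.map_apply hm measurableSet_Ioi, noiseLaw_map_frobInner_self,
                Measure.map_apply (by fun_prop) measurableSet_Ioi]
              exact measure_mono fun c hc => lt_of_mul_lt_mul_left hc (sq_nonneg σ)
    _ = _ := by rw [lintegral_const, measure_univ, mul_one]

lemma mechanismC_private_of_maskedVarianceBound (hnp : p < n) {ε δ σ : ℝ}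
    (hε : 0 < ε) (hδ₀ : 0 < δ) (hσ : 0 < σ) (h : maskedVarianceBound n p ε δ ≤ σ ^ 2) :
    IsDifferentiallyPrivate (mechanismC n p σ) ε δ := by
  intro X X' hXX' S hS
  have hσ2 : (0 : ℝ) < σ ^ 2 := by positivity
  have hd : (0 : ℝ) < n - p := sub_pos.mpr (by exact_mod_cast hnp)
  obtain ⟨k, hk⟩ := hXX'.2.2.2
  have hD := hXX'.frobInner_sub_le
  have hm : Measurable fun C : Matrix (Fin n) (Fin p) ℝ => frobInner C C :=
    (show Continuous fun C : Matrix (Fin n) (Fin p) ℝ => frobInner C C by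
      unfold frobInner; fun_prop).measurable
  refine measure_le_of_good_set (measurableSet_le hm measurable_const)
    (mechanismC_large_norm_le hδ₀ hXX'.1) ?_ hS
  intro T hT hTm
  rw [mechanismC_apply_eq_setLIntegral hσ X hTm, mechanismC_apply_eq_setLIntegral hσ X' hTm,
    ← lintegral_const_mul' _ _ ENNReal.ofReal_ne_top]
  refine setLIntegral_mono' hTm fun Y hY => ?_
  rw [← ENNReal.ofReal_mul (Real.exp_pos _).le]
  refine ENNReal.ofReal_le_ofReal ?_
  have hYG : frobInner Y Y ≤ 2 * (n * p) + 2 * (σ ^ 2 * chiSquaredQuantile δ (n * p)) := hT hY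
  have horbit := orbitIntegral_le hnp hXX'.1 hXX'.2.1 hD hk ((σ ^ 2)⁻¹ • Y)
  have hloss := privacy_loss_le hnp hε hσ2 h
  -- The orbital estimate carries √p while the noise bound is stated with p; the difference is
  -- discarded here.
  have hsqrt : √(p : ℝ) ≤ p := by
    rcases Nat.eq_zero_or_pos p with rfl | hp
    · simp
    · exact Real.sqrt_le_self_iff.mpr (Or.inr (by exact_mod_cast hp))
  have hexp : frobInner ((σ ^ 2)⁻¹ • Y) ((σ ^ 2)⁻¹ • Y) * √p / ((n : ℝ) - p) ≤
      (2 * (n * p) + 2 * (σ ^ 2 * chiSquaredQuantile δ (n * p))) / (σ ^ 2) ^ 2 * p /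
        ((n : ℝ) - p) := by
    rw [frobInner_smul_left, frobInner_smul_right]
    have hY0 := frobInner_self_nonneg Y
    have heq : (σ ^ 2)⁻¹ * ((σ ^ 2)⁻¹ * frobInner Y Y) = frobInner Y Y / (σ ^ 2) ^ 2 := by
      field_simp
    rw [heq]
    refine div_le_div_of_nonneg_right ?_ hd.le
    exact mul_le_mul (div_le_div_of_nonneg_right hYG (by positivity)) hsqrt (Real.sqrt_nonneg _)
      -- The threshold is nonnegative because it dominates ‖Y‖², so no sign of the χ² quantile is
      -- needed.
      (div_nonneg (hY0.trans hYG) (by positivity))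
  have hnorm : -(frobInner X X / 2 / σ ^ 2) ≤ √p / σ ^ 2 + -(frobInner X' X' / 2 / σ ^ 2) := by
    have h1 := frobInner_self_sub_le hXX'.1 hXX'.2.1 hD hk
    rw [← sub_eq_add_neg, ← sub_div, ← neg_div]
    exact div_le_div_of_nonneg_right (by linarith) hσ2.le
  calc _ ≤ Real.exp (-(frobInner X X / 2 / σ ^ 2)) *
        (Real.exp (frobInner ((σ ^ 2)⁻¹ • Y) ((σ ^ 2)⁻¹ • Y) * √p / ((n : ℝ) - p)) *
          orbitIntegral X' ((σ ^ 2)⁻¹ • Y)) := by gcongr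
    _ = Real.exp (-(frobInner X X / 2 / σ ^ 2) +
        frobInner ((σ ^ 2)⁻¹ • Y) ((σ ^ 2)⁻¹ • Y) * √p / ((n : ℝ) - p)) *
          orbitIntegral X' ((σ ^ 2)⁻¹ • Y) := by rw [Real.exp_add, mul_assoc]
    _ ≤ Real.exp (ε + -(frobInner X' X' / 2 / σ ^ 2)) * orbitIntegral X' ((σ ^ 2)⁻¹ • Y) := by
        refine mul_le_mul_of_nonneg_right (Real.exp_le_exp.mpr ?_) (orbitIntegral_pos _ _).le
        linarith
    _ = _ := by rw [Real.exp_add, mul_assoc]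

end Privacy

theorem mainTheorem4 (n p : ℕ) (hp : 0 < p) (hnp : p < n)
    (ε δ σ : ℝ) (hε₀ : 0 < ε) (hε₁ : ε < 1) (hδ₀ : 0 < δ) (hδ₁ : δ < 1 / 2)
    (hσ : min (unmaskedBound ε δ) (√(maskedVarianceBound n p ε δ)) ≤ σ) :
    IsDifferentiallyPrivate (mechanismB n p σ) ε δ ∧
      IsDifferentiallyPrivate (mechanismC n p σ) ε δ := by
  rw [funext fun X => mechanismB_eq_mechanismC (n := n) (p := p) σ X, and_self]
  rcases min_le_iff.mp hσ with h | h
  · exact mechanismC_private_of_unmaskedBound hε₀ hε₁ hδ₀ hδ₁ h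
  -- Positivity of σ is not assumed; it follows from that of the variance bound.
  · have hpos := maskedVarianceBound_pos hp hnp hε₀ δ
    exact mechanismC_private_of_maskedVarianceBound hnp hε₀ hδ₀
      ((Real.sqrt_pos.mpr hpos).trans_le h) (Real.sqrt_le_iff.mp h).2
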